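/- Let $F$ be a field of characteristic $0$; algebras over $F$ are not assumed associative or unital. A superalgebra is an algebra $A=A_0\oplus A_1$ with $A_iA_j\subseteq A_{i+j\,(\mathrm{mod}\ 2)}$. Let $G=G_0\oplus G_1$ be the Grassmann algebra over $F$ on countably many anticommuting generators, and let $G(A)=G_0\otimes A_0+G_1\otimes A_1\subseteq G\otimes A$ be the Grassmann envelope of $A$. For a variety $\mathcal V$ of algebras, a $\mathcal V$-superalgebra is a superalgebra $A$ with $G(A)\in\mathcal V$; the class of all of them is denoted by $\widetilde{\mathcal V}$. For a multilinear nonassociative polynomial $f$, a superalgebra satisfies the superidentity $\tilde f=0$ if $\tilde f$ vanishes under all substitutions of homogeneous elements for the variables, where $\tilde f$ is obtained from $f$ by the Koszul rule: each monomial is multiplied by $-1$ for every pair of variables with odd values whose order in the monomial is opposite to a fixed order of the variables. For $r,s\ge 0$ let $\mathcal V_{r,s}$ be the supervariety generated by the free $\mathcal V$-superalgebra on $r$ even and $s$ odd generators, i.e. the class of all superalgebras that satisfy every superidentity of that free superalgebra (in particular, $\mathcal V_{0,0}=\{\{0\}\}$). The basic superrank of $\mathcal V$ is called infinite if $\mathcal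 V_{r,s}\neq\widetilde{\mathcal V}$ for all $r,s$. Let $\mathfrak M$ be the variety of all metabelian algebras over $F$, i.e. the variety of all algebras defined by the identity $(xy)(zt)=0$. Then the basic superrank of $\mathfrak M$ is infinite: $\mathfrak M_{r,s}\neq\widetilde{\mathfrak M}$ for all integers $r,s\ge 0$. -/

import Mathlib

universe u

open scoped TensorProduct

noncomputable section

/-- A superalgebra over `F`: a (not necessarily associative or unital) `F`-algebra that is the
direct sum of an even part `part 0` and an odd part `part 1`, with
`part i * part j ⊆ part (i + j)`. -/
structure Superalgebra (F : Type u) [Field F] where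
  carrier : Type u
  [ring : NonUnitalNonAssocRing carrier]
  [module : Module F carrier]
  [tower : IsScalarTower F carrier carrier]
  [comm : SMulCommClass F carrier carrier]
  part : ZMod 2 → Submodule F carrier
  isCompl : IsCompl (part 0) (part 1)
  mul_mem : ∀ (i j : ZMod 2) (a b : carrier), a ∈ part i → b ∈ part j → a * b ∈ part (i + j)

attribute [instance] Superalgebra.ring Superalgebra.module Superalgebra.tower Superalgebra.comm

/-- Nonassociative polynomials over `F` in the variables `x₀, x₁, x₂, …`. -/
abbrev NAPoly (F : Type u) [Field F] : Type u := FreeNonUnitalNonAssocAlgebra F ℕ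

/-! ### Identities, Grassmann envelope, superidentities -/

/-- The algebra `A` belongs to the variety of algebras defined by the identities `f = 0`, `f ∈ S`. -/
def MemVariety {F : Type u} [Field F] (S : Set (NAPoly F)) (A : Type*) [NonUnitalNonAssocRing A]
    [Module F A] [IsScalarTower F A A] [SMulCommClass F A A] : Prop :=
  ∀ f ∈ S, ∀ v : ℕ → A, FreeNonUnitalNonAssocAlgebra.lift F v f = 0

/-- The Grassmann algebra on the countable set of generators `e₀, e₁, …`. -/
abbrev Grassmann (F : Type u) [Field F] : Type u := ExteriorAlgebra F (ℕ →₀ F)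

/-- The even part (`i = 0`) and the odd part (`i = 1`) of the Grassmann algebra, spanned by
the words of even, respectively odd, length in the generators. -/
def Grassmann.part (F : Type u) [Field F] (i : ZMod 2) : Submodule F (Grassmann F) :=
  CliffordAlgebra.evenOdd (0 : QuadraticForm F (ℕ →₀ F)) i

namespace Superalgebra

variable {F : Type u} [Field F]

/-- The subspace `G_i ⊗ A_i` of `G ⊗ A`. -/
def envelopePart (A : Superalgebra F) (i : ZMod 2) :
    Submodule F (Grassmann F ⊗[F] A.carrier) :=
  Submodule.span F {t | ∃ g ∈ Grassmann.part F i, ∃ a ∈ A.part i, g ⊗ₜ[F] a = t}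

theorem envelopePart_mul (A : Superalgebra F) (i j : ZMod 2)
    (x y : Grassmann F ⊗[F] A.carrier) (hx : x ∈ A.envelopePart i) (hy : y ∈ A.envelopePart j) :
    x * y ∈ A.envelopePart (i + j) := by
  unfold envelopePart at hx hy
  induction hx, hy using Submodule.span_induction₂ with
  | mem_mem x y hx hy =>
    obtain ⟨g, hg, a, ha, rfl⟩ := hx
    obtain ⟨h, hh, b, hb, rfl⟩ := hy
    rw [Algebra.TensorProduct.tmul_mul_tmul]
    exact Submodule.subset_span ⟨g * h,
      SetLike.GradedMul.mul_mem (A := CliffordAlgebra.evenOdd (0 : QuadraticForm F (ℕ →₀ F))) hg hh,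
      a * b, A.mul_mem i j a b ha hb, rfl⟩
  | zero_left y hy => rw [zero_mul]; exact Submodule.zero_mem _
  | zero_right x hx => rw [mul_zero]; exact Submodule.zero_mem _
  | add_left x y z _ _ _ h1 h2 => rw [add_mul]; exact Submodule.add_mem _ h1 h2
  | add_right x y z _ _ _ h1 h2 => rw [mul_add]; exact Submodule.add_mem _ h1 h2
  | smul_left r x y _ _ h => rw [smul_mul_assoc]; exact Submodule.smul_mem _ r h
  | smul_right r x y _ _ h => rw [mul_smul_comm]; exact Submodule.smul_mem _ r h

/-- The Grassmann envelope `G(A) = G₀ ⊗ A₀ + G₁ ⊗ A₁`, a subalgebra of `G ⊗ A`. -/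
def envelope (A : Superalgebra F) : NonUnitalSubalgebra F (Grassmann F ⊗[F] A.carrier) :=
  { A.envelopePart 0 ⊔ A.envelopePart 1 with
    mul_mem' := by
      intro x y hx hy
      obtain ⟨x0, hx0, x1, hx1, rfl⟩ := Submodule.mem_sup.1 hx
      obtain ⟨y0, hy0, y1, hy1, rfl⟩ := Submodule.mem_sup.1 hy
      have h00 := A.envelopePart_mul 0 0 x0 y0 hx0 hy0
      have h01 := A.envelopePart_mul 0 1 x0 y1 hx0 hy1
      have h10 := A.envelopePart_mul 1 0 x1 y0 hx1 hy0
      have h11 := A.envelopePart_mul 1 1 x1 y1 hx1 hy1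
      have e : (x0 + x1) * (y0 + y1) = (x0 * y0 + x1 * y1) + (x0 * y1 + x1 * y0) := by
        rw [add_mul, mul_add, mul_add]; abel
      rw [e]
      exact Submodule.mem_sup.2 ⟨_, Submodule.add_mem _ h00 h11, _, Submodule.add_mem _ h01 h10, rfl⟩ }

/-- The class of all `V`-superalgebras, where `V` is the variety of algebras defined by the
identities in `S`: the superalgebras whose Grassmann envelope lies in `V`. -/
def ofVariety (S : Set (NAPoly F)) : Set (Superalgebra F) :=
  {A | MemVariety S A.envelope}

end Superalgebra

/-- The list of letters of a nonassociative word, read from left to right. -/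
def FreeMagma.letters {X : Type*} : FreeMagma X → List X
  | .of x => [x]
  | .mul a b => FreeMagma.letters a ++ FreeMagma.letters b

/-- A nonassociative polynomial is multilinear if, for some finite set `s` of variables, each
of its monomials contains every variable from `s` exactly once and no other variables. -/
def NAPoly.IsMultilinear {F : Type u} [Field F] (f : NAPoly F) : Prop :=
  ∃ s : Finset ℕ, ∀ m ∈ f.coeff.support, (m.letters : Multiset ℕ) = s.val

/-- The sign given by the Koszul rule for a word in variables `x_i` of parity `p i`: a factor
`-1` for each pair of odd variables whose order in the word differs from the standard order. -/
def koszulSign (p : ℕ → ZMod 2) : List ℕ → ℤ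
  | [] => 1
  | i :: l => (l.map fun j => if j < i ∧ p i = 1 ∧ p j = 1 then (-1 : ℤ) else 1).prod *
      koszulSign p l

namespace Superalgebra

variable {F : Type u} [Field F]

/-- The value of the superpolynomial corresponding to the (multilinear) polynomial `f` at the
homogeneous elements `a i` of parity `p i`. -/
def superEval (A : Superalgebra F) (p : ℕ → ZMod 2) (a : ℕ → A.carrier) (f : NAPoly F) :
    A.carrier :=
  f.coeff.sum fun m c => c • koszulSign p m.letters • FreeMagma.lift a m

/-- `A` satisfies the superidentity corresponding to the multilinear polynomial `f`. -/
def SatisfiesSuper (A : Superalgebra F) (f : NAPoly F) : Prop :=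
  ∀ (p : ℕ → ZMod 2) (a : ℕ → A.carrier), (∀ i, a i ∈ A.part (p i)) → A.superEval p a f = 0

/-- The supervariety generated by `B`: all superalgebras satisfying every superidentity of `B`. -/
def generated (B : Superalgebra F) : Set (Superalgebra F) :=
  {A | ∀ f : NAPoly F, f.IsMultilinear → B.SatisfiesSuper f → A.SatisfiesSuper f}

/-! ### Quotients by graded ideals -/

/-- A two-sided ideal that contains the homogeneous components of each of its elements. -/
structure GradedIdeal (A : Superalgebra F) where
  toSubmodule : Submodule F A.carrier
  mul_left_mem : ∀ a x, x ∈ toSubmodule → a * x ∈ toSubmodule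
  mul_right_mem : ∀ a x, x ∈ toSubmodule → x * a ∈ toSubmodule
  even_mem : ∀ x ∈ A.part 0, ∀ y ∈ A.part 1, x + y ∈ toSubmodule → x ∈ toSubmodule
  odd_mem : ∀ x ∈ A.part 0, ∀ y ∈ A.part 1, x + y ∈ toSubmodule → y ∈ toSubmodule

namespace GradedIdeal

variable {A : Superalgebra F}

/-- The intersection of a family of graded ideals (the whole algebra for the empty family). -/
def sInter (T : Set A.GradedIdeal) : A.GradedIdeal where
  toSubmodule := ⨅ J ∈ T, J.toSubmodule
  mul_left_mem a x hx := by
    simp only [Submodule.mem_iInf] at hx ⊢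
    exact fun J hJ => J.mul_left_mem a x (hx J hJ)
  mul_right_mem a x hx := by
    simp only [Submodule.mem_iInf] at hx ⊢
    exact fun J hJ => J.mul_right_mem a x (hx J hJ)
  even_mem x hx y hy h := by
    simp only [Submodule.mem_iInf] at h ⊢
    exact fun J hJ => J.even_mem x hx y hy (h J hJ)
  odd_mem x hx y hy h := by
    simp only [Submodule.mem_iInf] at h ⊢
    exact fun J hJ => J.odd_mem x hx y hy (h J hJ)

/-- The underlying vector space of the quotient superalgebra. -/
abbrev Quot (J : A.GradedIdeal) : Type u := A.carrier ⧸ J.toSubmodule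

instance (J : A.GradedIdeal) : Mul J.Quot where
  mul := Quotient.map₂ (· * ·) (by
    intro a a' ha b b' hb
    have ha' := (Submodule.quotientRel_def _).1 ha
    have hb' := (Submodule.quotientRel_def _).1 hb
    refine (Submodule.quotientRel_def _).2 ?_
    have e : a * b - a' * b' = (a - a') * b + a' * (b - b') := by
      rw [sub_mul, mul_sub]; abel
    change a * b - a' * b' ∈ _
    rw [e]
    exact Submodule.add_mem _ (J.mul_right_mem _ _ ha') (J.mul_left_mem _ _ hb'))

theorem mk_mul (J : A.GradedIdeal) (a b : A.carrier) :
    J.toSubmodule.mkQ (a * b) = J.toSubmodule.mkQ a * J.toSubmodule.mkQ b := rfl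

instance (J : A.GradedIdeal) : NonUnitalNonAssocRing J.Quot :=
  { (inferInstance : AddCommGroup J.Quot), (inferInstance : Mul J.Quot) with
    left_distrib := by
      intro x y z
      obtain ⟨a, rfl⟩ := J.toSubmodule.mkQ_surjective x
      obtain ⟨b, rfl⟩ := J.toSubmodule.mkQ_surjective y
      obtain ⟨c, rfl⟩ := J.toSubmodule.mkQ_surjective z
      rw [← map_add, ← mk_mul, ← mk_mul, ← mk_mul, ← map_add, mul_add]
    right_distrib := by
      intro x y z
      obtain ⟨a, rfl⟩ := J.toSubmodule.mkQ_surjective x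
      obtain ⟨b, rfl⟩ := J.toSubmodule.mkQ_surjective y
      obtain ⟨c, rfl⟩ := J.toSubmodule.mkQ_surjective z
      rw [← map_add, ← mk_mul, ← mk_mul, ← mk_mul, ← map_add, add_mul]
    zero_mul := by
      intro x
      obtain ⟨a, rfl⟩ := J.toSubmodule.mkQ_surjective x
      rw [← map_zero J.toSubmodule.mkQ, ← mk_mul, zero_mul]
    mul_zero := by
      intro x
      obtain ⟨a, rfl⟩ := J.toSubmodule.mkQ_surjective x
      rw [← map_zero J.toSubmodule.mkQ, ← mk_mul, mul_zero] }

instance (J : A.GradedIdeal) : IsScalarTower F J.Quot J.Quot where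
  smul_assoc r x y := by
    obtain ⟨a, rfl⟩ := J.toSubmodule.mkQ_surjective x
    obtain ⟨b, rfl⟩ := J.toSubmodule.mkQ_surjective y
    rw [smul_eq_mul, smul_eq_mul, ← map_smul, ← mk_mul, ← mk_mul, ← map_smul, smul_mul_assoc]

instance (J : A.GradedIdeal) : SMulCommClass F J.Quot J.Quot where
  smul_comm r x y := by
    obtain ⟨a, rfl⟩ := J.toSubmodule.mkQ_surjective x
    obtain ⟨b, rfl⟩ := J.toSubmodule.mkQ_surjective y
    rw [smul_eq_mul, smul_eq_mul, ← map_smul, ← mk_mul, ← mk_mul, ← map_smul, mul_smul_comm]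

end GradedIdeal

/-- The quotient superalgebra `A / J`. -/
def quotient (A : Superalgebra F) (J : A.GradedIdeal) : Superalgebra F where
  carrier := J.Quot
  part i := (A.part i).map J.toSubmodule.mkQ
  isCompl := by
    constructor
    · rw [Submodule.disjoint_def]
      rintro _ ⟨a, ha, rfl⟩ ⟨b, hb, hab⟩
      have h : a + -b ∈ J.toSubmodule := by
        rw [← sub_eq_add_neg]
        exact (Submodule.Quotient.eq _).1 hab.symm
      have := J.even_mem a ha (-b) (Submodule.neg_mem _ hb) h
      exact (Submodule.Quotient.mk_eq_zero _).2 this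
    · rw [codisjoint_iff, ← Submodule.map_sup, codisjoint_iff.1 A.isCompl.codisjoint,
        Submodule.map_top, Submodule.range_mkQ]
  mul_mem := by
    rintro i j _ _ ⟨a, ha, rfl⟩ ⟨b, hb, rfl⟩
    exact ⟨a * b, A.mul_mem i j a b ha hb, rfl⟩

/-! ### Free superalgebras -/

/-- The parity of a nonassociative word in even generators (left summand) and odd generators
(right summand): the number of its odd letters modulo 2. -/
def wordParity (r s : ℕ) : FreeMagma (Fin r ⊕ Fin s) → ZMod 2
  | .of (.inl _) => 0
  | .of (.inr _) => 1
  | .mul a b => wordParity r s a + wordParity r s b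

/-- The free nonassociative superalgebra on `r` even and `s` odd generators. -/
def freeNonassoc (F : Type u) [Field F] (r s : ℕ) : Superalgebra F where
  carrier := FreeNonUnitalNonAssocAlgebra F (Fin r ⊕ Fin s)
  part i := Submodule.span F
    {w | ∃ m : FreeMagma (Fin r ⊕ Fin s), wordParity r s m = i ∧ MonoidAlgebra.single m 1 = w}
  isCompl := by
    have key : ∀ (i : ZMod 2) (w : FreeNonUnitalNonAssocAlgebra F (Fin r ⊕ Fin s)),
        w ∈ Submodule.span F {w | ∃ m : FreeMagma (Fin r ⊕ Fin s),
          wordParity r s m = i ∧ MonoidAlgebra.single m 1 = w} →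
        ∀ m, wordParity r s m ≠ i → w.coeff m = 0 := by
      intro i w hw m hm
      induction hw using Submodule.span_induction with
      | mem x hx =>
        obtain ⟨n, hn, rfl⟩ := hx
        rw [MonoidAlgebra.coeff_single]
        exact Finsupp.single_eq_of_ne (fun h => hm (h ▸ hn))
      | zero => rfl
      | add x y _ _ h1 h2 => rw [MonoidAlgebra.coeff_add, Finsupp.add_apply, h1, h2, add_zero]
      | smul c x _ h => rw [MonoidAlgebra.coeff_smul, Finsupp.smul_apply, h, smul_zero]
    constructor
    · rw [Submodule.disjoint_def]
      intro w h0 h1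
      ext m
      by_cases h : wordParity r s m = 0
      · exact key 1 w h1 m (by rw [h]; decide)
      · exact key 0 w h0 m h
    · rw [codisjoint_iff, eq_top_iff]
      intro w _
      induction w using MonoidAlgebra.induction_linear with
      | zero => exact Submodule.zero_mem _
      | add x y hx hy => exact Submodule.add_mem _ (hx trivial) (hy trivial)
      | single m c =>
        have e : (MonoidAlgebra.single m c : FreeNonUnitalNonAssocAlgebra F (Fin r ⊕ Fin s))
            = c • MonoidAlgebra.single m 1 := by
          rw [MonoidAlgebra.smul_single, smul_eq_mul, mul_one]
        rw [e]
        apply Submodule.smul_mem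
        have h2 : ∀ i : ZMod 2, i = 0 ∨ i = 1 := by decide
        rcases h2 (wordParity r s m) with h | h
        · exact Submodule.mem_sup_left (Submodule.subset_span ⟨m, h, rfl⟩)
        · exact Submodule.mem_sup_right (Submodule.subset_span ⟨m, h, rfl⟩)
  mul_mem := by
    intro i j a b ha hb
    induction ha, hb using Submodule.span_induction₂ with
    | mem_mem x y hx hy =>
      obtain ⟨m, hm, rfl⟩ := hx
      obtain ⟨n, hn, rfl⟩ := hy
      refine Submodule.subset_span ⟨m * n, ?_, ?_⟩
      · rw [← hm, ← hn]; rfl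
      · rw [MonoidAlgebra.single_mul_single, mul_one]
    | zero_left y hy => rw [zero_mul]; exact Submodule.zero_mem _
    | zero_right x hx => rw [mul_zero]; exact Submodule.zero_mem _
    | add_left x y z _ _ _ h1 h2 => rw [add_mul]; exact Submodule.add_mem _ h1 h2
    | add_right x y z _ _ _ h1 h2 => rw [mul_add]; exact Submodule.add_mem _ h1 h2
    | smul_left r x y _ _ h => rw [smul_mul_assoc]; exact Submodule.smul_mem _ r h
    | smul_right r x y _ _ h => rw [mul_smul_comm]; exact Submodule.smul_mem _ r h

/-- The free `V`-superalgebra on `r` even and `s` odd generators, `V` being the variety defined by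
`S`: the quotient of the free nonassociative superalgebra by its smallest graded ideal with a
`V`-superalgebra as quotient (the intersection of all such ideals). -/
def free (S : Set (NAPoly F)) (r s : ℕ) : Superalgebra F :=
  (freeNonassoc F r s).quotient
    (GradedIdeal.sInter {J | (freeNonassoc F r s).quotient J ∈ ofVariety S})

/-- The supervariety `V_{r,s}` generated by the free `V`-superalgebra on `r` even and `s` odd
generators. For `r = s = 0` the latter is zero, and `V_{0,0}` consists of the zero superalgebras. -/
def superVar (S : Set (NAPoly F)) (r s : ℕ) : Set (Superalgebra F) :=
  (free S r s).generated

end Superalgebra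

/-- The basic superrank of the variety `V` defined by the identities `S` is infinite: for no
`(r, s)` does `V_{r,s}` coincide with the class of all `V`-superalgebras. -/
def HasInfiniteBasicSuperrank {F : Type u} [Field F] (S : Set (NAPoly F)) : Prop :=
  ∀ r s : ℕ, Superalgebra.superVar S r s ≠ Superalgebra.ofVariety S

/-- The defining identity `(x₀ x₁)(x₂ x₃) = 0` of the variety of all metabelian algebras. -/
def metabelianIdentities (F : Type u) [Field F] : Set (NAPoly F) :=
  let x : ℕ → NAPoly F := FreeNonUnitalNonAssocAlgebra.of F
  {(x 0 * x 1) * (x 2 * x 3)}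

end

/-! The proof counts dimensions. Being a monomial, the metabelian identity undergoes no sign change
on passing to the Grassmann envelope: a superalgebra lies in the class exactly when (ab)(cd) = 0 for
all its elements (`mem_ofVariety_metabelianIdentities`).

Let B be the free metabelian superalgebra on k = r + s generators, and consider combinations ∑ c_σ
x_{σ 0}(x_{σ 1}(⋯(x_n x_{n+1}))). In B a left multiplication applied to a product depends only on
the multiplier modulo products, hence on its k coordinates in the generators (`prod_mulLeft_congr`).
Expanding all multipliers, the superidentity follows from at most 2^(n+2) · k^n · k^n linear
equations on c, one for each choice of parities p and of index functions g, h
(`satisfiesSuper_rightNormedPoly`). There are n! coefficients, which is more for a suitable n, so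
some c ≠ 0 gives a superidentity of B (`exists_ne_zero_forall_sum_koszulSign_eq_zero`).

On the other hand, some purely even metabelian algebra has all these right-normed words linearly
independent, so it satisfies no such superidentity (`eq_zero_of_metabelianWords_satisfiesSuper`). It
therefore lies outside the supervariety generated by B. -/

noncomputable section

/-! ### The defining identity of metabelian superalgebras -/

/-! ### Nonvanishing words in the Grassmann algebra. -/

section Grassmann

variable (F : Type u) [Field F]

/-- The unit if `q = 0`, and the `i`-th generator of the Grassmann algebra otherwise. -/
def Grassmann.homogeneousLetter (q : ZMod 2) (i : ℕ) : Grassmann F :=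
  if q = 0 then 1 else ExteriorAlgebra.ι F (Finsupp.single i 1)

theorem Grassmann.homogeneousLetter_mem (q : ZMod 2) (i : ℕ) :
    Grassmann.homogeneousLetter F q i ∈ Grassmann.part F q := by
  unfold Grassmann.homogeneousLetter Grassmann.part
  split_ifs with h
  · subst h
    exact SetLike.GradedOne.one_mem
      (A := CliffordAlgebra.evenOdd (0 : QuadraticForm F (ℕ →₀ F)))
  · have h1 : q = 1 := (by decide : ∀ q : ZMod 2, q ≠ 0 → q = 1) q h
    subst h1
    exact CliffordAlgebra.ι_mem_evenOdd_one _ _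

/-- Contraction with the `j`-th coordinate is an antiderivation that kills every generator except
the `j`-th. -/
theorem Grassmann.contractLeft_prod_homogeneousLetter (p : ℕ → ZMod 2) (j : ℕ) (l : List ℕ)
    (hj : j ∉ l) :
    CliffordAlgebra.contractLeft (Q := (0 : QuadraticForm F (ℕ →₀ F))) (Finsupp.lapply j)
      (l.map fun i => Grassmann.homogeneousLetter F (p i) i).prod = 0 := by
  induction l with
  | nil => simp [CliffordAlgebra.contractLeft_one]
  | cons i l ih =>
    rw [List.mem_cons, not_or] at hj
    rw [List.map_cons, List.prod_cons, Grassmann.homogeneousLetter]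
    split_ifs with h
    · rw [one_mul, ih hj.2]
    · rw [ExteriorAlgebra.ι, CliffordAlgebra.contractLeft_ι_mul, ih hj.2, mul_zero, sub_zero,
        Finsupp.lapply_apply, Finsupp.single_eq_of_ne hj.1, zero_smul]

/-- Contracting with the coordinate of an odd first letter strips that letter off, because it does
not recur; a unit letter drops out by itself. -/
theorem Grassmann.prod_homogeneousLetter_ne_zero (p : ℕ → ZMod 2) (l : List ℕ) (hl : l.Nodup) :
    (l.map fun i => Grassmann.homogeneousLetter F (p i) i).prod ≠ 0 := by
  induction l with
  | nil => simp
  | cons i l ih =>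
    rw [List.nodup_cons] at hl
    rw [List.map_cons, List.prod_cons]
    intro h0
    rw [Grassmann.homogeneousLetter] at h0
    split_ifs at h0 with h
    · rw [one_mul] at h0
      exact ih hl.2 h0
    · have h1 := congrArg (CliffordAlgebra.contractLeft (Q := (0 : QuadraticForm F (ℕ →₀ F)))
        (Finsupp.lapply i)) h0
      rw [ExteriorAlgebra.ι, CliffordAlgebra.contractLeft_ι_mul,
        Grassmann.contractLeft_prod_homogeneousLetter F p i l hl.1, mul_zero, sub_zero,
        Finsupp.lapply_apply, Finsupp.single_eq_same, one_smul, map_zero] at h1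
      exact ih hl.2 h1

end Grassmann

theorem TensorProduct.eq_zero_of_tmul_eq_zero {F V W : Type*} [Field F] [AddCommGroup V]
    [Module F V] [AddCommGroup W] [Module F W] {g : V} {x : W} (hg : g ≠ 0)
    (h : g ⊗ₜ[F] x = 0) : x = 0 := by
  obtain ⟨φ, hφ⟩ : ∃ φ : Module.Dual F V, φ g ≠ 0 := by
    by_contra! hc
    exact hg ((Module.forall_dual_apply_eq_zero_iff F g).1 hc)
  have h1 := congrArg (TensorProduct.lid F W ∘ LinearMap.rTensor W φ) h
  simp only [Function.comp_apply, LinearMap.rTensor_tmul, TensorProduct.lid_tmul, map_zero] at h1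
  exact (smul_eq_zero.1 h1).resolve_left hφ

theorem memVariety_metabelianIdentities {F : Type u} [Field F] {A : Type*}
    [NonUnitalNonAssocRing A] [Module F A] [IsScalarTower F A A] [SMulCommClass F A A] :
    MemVariety (metabelianIdentities F) A ↔ ∀ a b c d : A, a * b * (c * d) = 0 := by
  constructor
  · intro h a b c d
    have := h _ rfl (fun i => if i = 0 then a else if i = 1 then b else if i = 2 then c else d)
    simpa [map_mul] using this
  · rintro h f rfl v
    simp only [map_mul]
    exact h _ _ _ _

namespace Superalgebra

variable {F : Type u} [Field F]

/-- A product of four elements vanishes if it does so on homogeneous elements. -/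
theorem mul_mul_mul_eq_zero_of_homogeneous (A : Superalgebra F)
    (h : ∀ (p : ℕ → ZMod 2) (a : ℕ → A.carrier), (∀ i, a i ∈ A.part (p i)) →
      a 0 * a 1 * (a 2 * a 3) = 0) (a b c d : A.carrier) : a * b * (c * d) = 0 := by
  have key : ∀ i j k l : ZMod 2, ∀ a ∈ A.part i, ∀ b ∈ A.part j, ∀ c ∈ A.part k, ∀ d ∈ A.part l,
      a * b * (c * d) = 0 := by
    intro i j k l a ha b hb c hc d hd
    have := h (fun n => if n = 0 then i else if n = 1 then j else if n = 2 then k else l)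
      (fun n => if n = 0 then a else if n = 1 then b else if n = 2 then c else d) (by
        intro n; split_ifs <;> assumption)
    simpa using this
  have dec : ∀ a : A.carrier, ∃ y ∈ A.part 0, ∃ z ∈ A.part 1, y + z = a := fun a =>
    Submodule.mem_sup.1 (by rw [codisjoint_iff.1 A.isCompl.codisjoint]; trivial)
  obtain ⟨a0, ha0, a1, ha1, rfl⟩ := dec a
  obtain ⟨b0, hb0, b1, hb1, rfl⟩ := dec b
  obtain ⟨c0, hc0, c1, hc1, rfl⟩ := dec c
  obtain ⟨d0, hd0, d1, hd1, rfl⟩ := dec d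
  simp only [add_mul, mul_add]
  rw [key 0 0 0 0 _ ha0 _ hb0 _ hc0 _ hd0, key 0 0 0 1 _ ha0 _ hb0 _ hc0 _ hd1,
    key 0 0 1 0 _ ha0 _ hb0 _ hc1 _ hd0, key 0 0 1 1 _ ha0 _ hb0 _ hc1 _ hd1,
    key 0 1 0 0 _ ha0 _ hb1 _ hc0 _ hd0, key 0 1 0 1 _ ha0 _ hb1 _ hc0 _ hd1,
    key 0 1 1 0 _ ha0 _ hb1 _ hc1 _ hd0, key 0 1 1 1 _ ha0 _ hb1 _ hc1 _ hd1,
    key 1 0 0 0 _ ha1 _ hb0 _ hc0 _ hd0, key 1 0 0 1 _ ha1 _ hb0 _ hc0 _ hd1,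
    key 1 0 1 0 _ ha1 _ hb0 _ hc1 _ hd0, key 1 0 1 1 _ ha1 _ hb0 _ hc1 _ hd1,
    key 1 1 0 0 _ ha1 _ hb1 _ hc0 _ hd0, key 1 1 0 1 _ ha1 _ hb1 _ hc0 _ hd1,
    key 1 1 1 0 _ ha1 _ hb1 _ hc1 _ hd0, key 1 1 1 1 _ ha1 _ hb1 _ hc1 _ hd1]
  simp only [add_zero]

theorem tmul_mem_envelope (A : Superalgebra F) {i : ZMod 2} {g : Grassmann F} {a : A.carrier}
    (hg : g ∈ Grassmann.part F i) (ha : a ∈ A.part i) : g ⊗ₜ[F] a ∈ A.envelope := by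
  have h : g ⊗ₜ[F] a ∈ A.envelopePart i := Submodule.subset_span ⟨g, hg, a, ha, rfl⟩
  rcases (by decide : ∀ i : ZMod 2, i = 0 ∨ i = 1) i with rfl | rfl
  · exact Submodule.mem_sup_left (S := A.envelopePart 0) (T := A.envelopePart 1) h
  · exact Submodule.mem_sup_right (S := A.envelopePart 0) (T := A.envelopePart 1) h

theorem mem_ofVariety_metabelianIdentities (A : Superalgebra F) :
    A ∈ ofVariety (metabelianIdentities F) ↔ ∀ a b c d : A.carrier, a * b * (c * d) = 0 := by
  change MemVariety _ _ ↔ _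
  rw [memVariety_metabelianIdentities]
  constructor
  · intro h
    refine A.mul_mul_mul_eq_zero_of_homogeneous fun p a ha => ?_
    -- Distinct Grassmann generators accompany the odd elements, so the Grassmann factor of the
    -- product is nonzero and can be cancelled.
    let g : ℕ → Grassmann F := fun i => Grassmann.homogeneousLetter F (p i) i
    let t : ℕ → A.envelope := fun i =>
      ⟨g i ⊗ₜ a i, A.tmul_mem_envelope (Grassmann.homogeneousLetter_mem F (p i) i) (ha i)⟩
    have h1 := congrArg Subtype.val (h (t 0) (t 1) (t 2) (t 3))
    change g 0 ⊗ₜ[F] a 0 * g 1 ⊗ₜ[F] a 1 * (g 2 ⊗ₜ[F] a 2 * g 3 ⊗ₜ[F] a 3) = 0 at h1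
    simp only [Algebra.TensorProduct.tmul_mul_tmul] at h1
    refine TensorProduct.eq_zero_of_tmul_eq_zero ?_ h1
    have h2 := Grassmann.prod_homogeneousLetter_ne_zero F p [0, 1, 2, 3] (by decide)
    simpa [mul_assoc] using h2
  · intro h
    have key : ∀ x y z t : Grassmann F ⊗[F] A.carrier, x * y * (z * t) = 0 := by
      intro x y z t
      induction x with
      | zero => simp
      | add _ _ h1 h2 => simp only [add_mul, h1, h2, add_zero]
      | tmul g a =>
      induction y with
      | zero => simp
      | add _ _ h1 h2 => simp only [add_mul, mul_add, h1, h2, add_zero]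
      | tmul g' b =>
      induction z with
      | zero => simp
      | add _ _ h1 h2 => simp only [add_mul, mul_add, h1, h2, add_zero]
      | tmul g'' c =>
      induction t with
      | zero => simp
      | add _ _ h1 h2 => simp only [mul_add, h1, h2, add_zero]
      | tmul g''' d => simp only [Algebra.TensorProduct.tmul_mul_tmul, h, TensorProduct.tmul_zero]
    exact fun a b c d => Subtype.ext (key a b c d)

/-! ### The free metabelian superalgebra modulo products. -/

/-- Each ideal with metabelian quotient contains all products (ab)(cd), hence so does the
intersection of these ideals. -/
theorem free_metabelianIdentities_mul_mul_mul (r s : ℕ)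
    (a b c d : (free (metabelianIdentities F) r s).carrier) : a * b * (c * d) = 0 := by
  obtain ⟨a, rfl⟩ := Submodule.mkQ_surjective _ a
  obtain ⟨b, rfl⟩ := Submodule.mkQ_surjective _ b
  obtain ⟨c, rfl⟩ := Submodule.mkQ_surjective _ c
  obtain ⟨d, rfl⟩ := Submodule.mkQ_surjective _ d
  refine (Submodule.Quotient.mk_eq_zero (x := a * b * (c * d)) _).2 ?_
  simp only [GradedIdeal.sInter, Submodule.mem_iInf]
  intro J hJ
  exact (Submodule.Quotient.mk_eq_zero _).1 ((mem_ofVariety_metabelianIdentities _).1 hJ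
    (J.toSubmodule.mkQ a) (J.toSubmodule.mkQ b) (J.toSubmodule.mkQ c) (J.toSubmodule.mkQ d))

theorem span_of_sup_span_mul (X : Type*) :
    Submodule.span F (Set.range (FreeNonUnitalNonAssocAlgebra.of F : X → _)) ⊔
      Submodule.span F {x | ∃ a b : FreeNonUnitalNonAssocAlgebra F X, a * b = x} = ⊤ := by
  rw [eq_top_iff]
  intro x _
  induction x using MonoidAlgebra.induction_linear with
  | zero => exact Submodule.zero_mem _
  | add x y hx hy => exact Submodule.add_mem _ (hx trivial) (hy trivial)
  | single m c =>
    have e : (MonoidAlgebra.single m c : FreeNonUnitalNonAssocAlgebra F X)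
        = c • MonoidAlgebra.single m 1 := by
      rw [MonoidAlgebra.smul_single, smul_eq_mul, mul_one]
    rw [e]
    apply Submodule.smul_mem
    cases m with
    | of k => exact Submodule.mem_sup_left (Submodule.subset_span ⟨k, rfl⟩)
    | mul m n =>
      refine Submodule.mem_sup_right (Submodule.subset_span
        ⟨MonoidAlgebra.single m 1, MonoidAlgebra.single n 1, ?_⟩)
      exact (MonoidAlgebra.single_mul_single ..).trans (by rw [mul_one]; rfl)

/-- Modulo products, a quotient of a free superalgebra is spanned by the free generators. -/
theorem exists_span_generators_sup_span_mul (r s : ℕ) (J : (freeNonassoc F r s).GradedIdeal) :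
    ∃ x : Fin r ⊕ Fin s → J.Quot, Submodule.span F (Set.range x) ⊔
      Submodule.span F {x : J.Quot | ∃ a b, a * b = x} = ⊤ := by
  let q : FreeNonUnitalNonAssocAlgebra F (Fin r ⊕ Fin s) →ₗ[F] J.Quot := J.toSubmodule.mkQ
  refine ⟨fun k => q (FreeNonUnitalNonAssocAlgebra.of F k), ?_⟩
  have hq : Function.Surjective q := J.toSubmodule.mkQ_surjective
  rw [← LinearMap.range_eq_top.2 hq, LinearMap.range_eq_map, ← span_of_sup_span_mul,
    Submodule.map_sup, Submodule.map_span, Submodule.map_span, ← Set.range_comp]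
  congr 2
  ext x
  constructor
  · rintro ⟨a, b, rfl⟩
    obtain ⟨a, rfl⟩ := hq a
    obtain ⟨b, rfl⟩ := hq b
    exact ⟨a * b, ⟨a, b, rfl⟩, rfl⟩
  · rintro ⟨_, ⟨a, b, rfl⟩, rfl⟩
    exact ⟨q a, q b, rfl⟩

end Superalgebra
end

noncomputable section

/-! ### Superidentities with too many alternatives for a finitely generated superalgebra -/

section Multilinear

variable {F : Type*} [Field F] {A : Type*} [NonUnitalNonAssocRing A] [Module F A]
  [IsScalarTower F A A] [SMulCommClass F A A]

/-- In a metabelian algebra, left multiplications restricted to products depend only on the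
multipliers modulo products. -/
theorem prod_mulLeft_congr (hA : ∀ a b c d : A, a * b * (c * d) = 0) (l : List ℕ) (y z : ℕ → A)
    (h : ∀ i, y i - z i ∈ Submodule.span F {x : A | ∃ a b, a * b = x}) (u v : A) :
    (l.map fun i => LinearMap.mulLeft F (y i)).prod (u * v) =
      (l.map fun i => LinearMap.mulLeft F (z i)).prod (u * v) := by
  have h0 : ∀ b ∈ Submodule.span F {x : A | ∃ a b, a * b = x}, ∀ u v : A, b * (u * v) = 0 := by
    intro b hb u v
    induction hb using Submodule.span_induction with
    | mem b hb => obtain ⟨c, d, rfl⟩ := hb; exact hA _ _ _ _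
    | zero => exact zero_mul _
    | add _ _ _ _ h1 h2 => rw [add_mul, h1, h2, add_zero]
    | smul c _ _ h => rw [smul_mul_assoc, h, smul_zero]
  -- After any number of left multiplications the argument is still a product, so the next
  -- multiplier may again be changed modulo products.
  have hp : ∀ l : List ℕ, ∃ u' v' : A,
      (l.map fun i => LinearMap.mulLeft F (z i)).prod (u * v) = u' * v' := by
    intro l
    cases l with
    | nil => exact ⟨u, v, rfl⟩
    | cons i l => exact ⟨_, _, rfl⟩
  induction l with
  | nil => rfl
  | cons i l ih =>
    simp only [List.map_cons, List.prod_cons, Module.End.mul_apply, LinearMap.mulLeft_apply]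
    obtain ⟨u', v', e⟩ := hp l
    rw [ih, e, ← sub_eq_zero, ← sub_mul]
    exact h0 _ (h i) _ _

/-- Expansion of a product of left multiplications by linear combinations. -/
theorem prod_mulLeft_sum {K : Type*} [Fintype K] (n : ℕ) (σ : Equiv.Perm (Fin n)) (x : K → A)
    (α : Fin n → K → F) :
    (List.ofFn fun i => LinearMap.mulLeft F (∑ k, α (σ i) k • x k)).prod =
      ∑ h : Fin n → K, (∏ j, α j (h j)) •
        (List.ofFn fun i => LinearMap.mulLeft F (x (h (σ i)))).prod := by
  classical
  -- The slots of `φ` are indexed by variables rather than by positions, so the coefficient `∏ j, α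
  -- j (h j)` does not depend on `σ`.
  let φ : MultilinearMap F (fun _ : Fin n => Module.End F A) (Module.End F A) :=
    (MultilinearMap.mkPiAlgebraFin F n (Module.End F A)).domDomCongr σ
  have hφ : ∀ m, φ m = (List.ofFn fun i => m (σ i)).prod := fun m => by
    simp only [φ, MultilinearMap.domDomCongr_apply, MultilinearMap.mkPiAlgebraFin_apply]
  have h1 := MultilinearMap.map_sum φ (fun j k => α j k • LinearMap.mulLeft F (x k))
  simp only [MultilinearMap.map_smul_univ] at h1
  simp only [hφ] at h1
  rw [← h1]
  congr 2
  ext i a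
  simp [LinearMap.sum_apply, Finset.sum_mul, smul_mul_assoc]

end Multilinear

/-! ### Koszul signs and right-normed words. -/

/-- This leaves only finitely many sign patterns: parities matter only on the `n + 2` variables that
occur. -/
theorem koszulSign_congr {p q : ℕ → ZMod 2} {l : List ℕ} (h : ∀ i ∈ l, p i = q i) :
    koszulSign p l = koszulSign q l := by
  induction l with
  | nil => rfl
  | cons i l ih =>
    rw [koszulSign, koszulSign, ih fun j hj => h j (List.mem_cons_of_mem _ hj)]
    congr 2
    refine List.map_congr_left fun j hj => ?_
    rw [h i List.mem_cons_self, h j (List.mem_cons_of_mem _ hj)]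

theorem koszulSign_zero (l : List ℕ) : koszulSign 0 l = 1 := by
  induction l with
  | nil => rfl
  | cons i l ih => simp [koszulSign, ih]

/-- The nonassociative word `x_{σ 0} (x_{σ 1} (⋯ (x_n x_{n+1})))`. -/
def rightNormedWord (n : ℕ) (σ : Equiv.Perm (Fin n)) : FreeMagma ℕ :=
  (List.ofFn fun i => (σ i : ℕ)).foldr (fun i m => FreeMagma.of i * m)
    (FreeMagma.of n * FreeMagma.of (n + 1))

theorem letters_foldr_mul (l : List ℕ) (m : FreeMagma ℕ) :
    (l.foldr (fun i m => FreeMagma.of i * m) m).letters = l ++ m.letters := by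
  induction l with
  | nil => rfl
  | cons i l ih => exact congrArg (i :: ·) ih

theorem letters_rightNormedWord (n : ℕ) (σ : Equiv.Perm (Fin n)) :
    (rightNormedWord n σ).letters = (List.ofFn fun i => (σ i : ℕ)) ++ [n, n + 1] :=
  letters_foldr_mul _ _

theorem coe_letters_rightNormedWord (n : ℕ) (σ : Equiv.Perm (Fin n)) :
    ((rightNormedWord n σ).letters : Multiset ℕ) = (Finset.range (n + 2)).val := by
  have h : ((List.ofFn fun i => (σ i : ℕ)) : Multiset ℕ) = Multiset.range n := by
    refine (Multiset.Nodup.ext (Multiset.coe_nodup.2 (List.nodup_ofFn.2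
      (Fin.val_injective.comp σ.injective))) (Multiset.nodup_range n)).2 fun i => ?_
    rw [Multiset.mem_coe, List.mem_ofFn, Multiset.mem_range]
    exact ⟨fun ⟨j, hj⟩ => hj ▸ (σ j).isLt, fun hi => ⟨σ.symm ⟨i, hi⟩, by simp⟩⟩
  rw [letters_rightNormedWord, ← Multiset.coe_add, h, Finset.range_val, Multiset.range_succ,
    Multiset.range_succ, add_comm, ← Multiset.cons_coe, ← Multiset.cons_coe, Multiset.coe_nil,
    Multiset.cons_add, Multiset.cons_add, zero_add, Multiset.cons_swap]

theorem lift_rightNormedWord {F : Type*} [Field F] {A : Type*} [NonUnitalNonAssocRing A]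
    [Module F A] [IsScalarTower F A A] [SMulCommClass F A A] (n : ℕ) (σ : Equiv.Perm (Fin n))
    (a : ℕ → A) :
    FreeMagma.lift a (rightNormedWord n σ) =
      ((List.ofFn fun i => (σ i : ℕ)).map fun i => LinearMap.mulLeft F (a i)).prod
        (a n * a (n + 1)) := by
  rw [rightNormedWord]
  induction (List.ofFn fun i => (σ i : ℕ)) with
  | nil => rfl
  | cons i l ih =>
    rw [List.foldr_cons, map_mul, ih]
    rfl

namespace Superalgebra

variable {F : Type u} [Field F]

/-- The polynomial `∑ c_σ x_{σ 0} (x_{σ 1} (⋯ (x_n x_{n+1})))`. -/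
def rightNormedPoly {n : ℕ} (c : Equiv.Perm (Fin n) → F) : NAPoly F :=
  .ofCoeff ((Finsupp.equivFunOnFinite.symm c).mapDomain (rightNormedWord n))

theorem isMultilinear_rightNormedPoly {n : ℕ} (c : Equiv.Perm (Fin n) → F) :
    (rightNormedPoly c).IsMultilinear := by
  classical
  refine ⟨Finset.range (n + 2), fun m hm => ?_⟩
  obtain ⟨σ, _, rfl⟩ := Finset.mem_image.1 (Finsupp.mapDomain_support hm)
  exact coe_letters_rightNormedWord n σ

theorem superEval_rightNormedPoly (A : Superalgebra F) (p : ℕ → ZMod 2) (a : ℕ → A.carrier)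
    {n : ℕ} (c : Equiv.Perm (Fin n) → F) :
    A.superEval p a (rightNormedPoly c) =
      ∑ σ, c σ • koszulSign p (rightNormedWord n σ).letters •
        FreeMagma.lift a (rightNormedWord n σ) := by
  have h := Finsupp.linearCombination_mapDomain F
    (v' := fun m : FreeMagma ℕ => koszulSign p m.letters • FreeMagma.lift a m)
    (rightNormedWord n) (Finsupp.equivFunOnFinite.symm c)
  exact h.trans (Finsupp.sum_fintype _ _ fun _ => zero_smul F _)

/-- A metabelian superalgebra that is spanned modulo products by the elements `x k` satisfies a
superidentity as soon as the coefficients satisfy the listed linear equations. -/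
theorem satisfiesSuper_rightNormedPoly (A : Superalgebra F)
    (hA : ∀ a b c d : A.carrier, a * b * (c * d) = 0) {K : Type*} [Fintype K] [DecidableEq K]
    (x : K → A.carrier)
    (hx : Submodule.span F (Set.range x) ⊔
      Submodule.span F {x : A.carrier | ∃ a b, a * b = x} = ⊤) {n : ℕ}
    (c : Equiv.Perm (Fin n) → F)
    (hc : ∀ (p : Fin (n + 2) → ZMod 2) (g h : Fin n → K),
      ∑ σ : Equiv.Perm (Fin n), (if h ∘ σ = g then
        (koszulSign (fun i => if hi : i < n + 2 then p ⟨i, hi⟩ else 0)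
          (rightNormedWord n σ).letters : F) else 0) * c σ = 0) :
    A.SatisfiesSuper (rightNormedPoly c) := by
  intro p a _
  have hα : ∀ i, ∃ α : K → F, a i - ∑ k, α k • x k ∈
      Submodule.span F {x : A.carrier | ∃ a b, a * b = x} := by
    intro i
    obtain ⟨y, hy, z, hz, e⟩ := Submodule.mem_sup.1
      (show a i ∈ Submodule.span F (Set.range x) ⊔
        Submodule.span F {x : A.carrier | ∃ a b, a * b = x} by rw [hx]; trivial)
    obtain ⟨α, rfl⟩ := (Submodule.mem_span_range_iff_exists_fun F).1 hy
    exact ⟨α, by rwa [← e, add_sub_cancel_left]⟩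
  choose α hα using hα
  -- The inner product `a n * a (n + 1)` is common to all `σ` and stays unexpanded; its two
  -- variables enter the equations only through their parities.
  let op : (Fin n → K) → A.carrier := fun g =>
    (List.ofFn fun i => LinearMap.mulLeft F (x (g i))).prod (a n * a (n + 1))
  have hop : ∀ σ, FreeMagma.lift a (rightNormedWord n σ) =
      ∑ h : Fin n → K, (∏ j : Fin n, α j (h j)) • op (h ∘ σ) := by
    intro σ
    rw [lift_rightNormedWord (F := F), prod_mulLeft_congr hA _ a (fun i => ∑ k, α i k • x k) hα,
      List.map_ofFn]
    have h1 := prod_mulLeft_sum n σ x (fun j => α j)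
    refine (LinearMap.congr_fun h1 _).trans ?_
    simp only [LinearMap.sum_apply, LinearMap.smul_apply]
    rfl
  have hsign : ∀ σ : Equiv.Perm (Fin n), koszulSign p (rightNormedWord n σ).letters =
      koszulSign (fun i => if hi : i < n + 2 then p i else 0) (rightNormedWord n σ).letters := by
    intro σ
    refine koszulSign_congr fun i hi => ?_
    rw [← Multiset.mem_coe, coe_letters_rightNormedWord, Finset.mem_val, Finset.mem_range] at hi
    rw [dif_pos hi]
  rw [superEval_rightNormedPoly]
  simp only [hop]
  -- For fixed `h`, the terms are grouped by `g = h ∘ σ`; the coefficient of each `op g` is one of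
  -- the expressions that `hc` makes zero.
  have hcomb : ∀ h : Fin n → K,
      ∑ σ, (c σ * (koszulSign p (rightNormedWord n σ).letters : F)) • op (h ∘ σ) = 0 := by
    intro h
    have e : ∀ σ : Equiv.Perm (Fin n), op (h ∘ σ) =
        ∑ g : Fin n → K, (if h ∘ σ = g then (1 : F) else 0) • op g := by
      intro σ; simp [ite_smul]
    simp only [e, Finset.smul_sum, smul_smul]
    rw [Finset.sum_comm]
    refine Finset.sum_eq_zero fun g _ => ?_
    rw [← Finset.sum_smul]
    refine smul_eq_zero_of_left ?_ _
    refine Eq.trans (Finset.sum_congr rfl fun σ _ => ?_) (hc (fun i => p i) g h)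
    rw [hsign]
    split_ifs <;> ring
  simp only [← Int.cast_smul_eq_zsmul F, Finset.smul_sum]
  rw [Finset.sum_comm]
  refine Finset.sum_eq_zero fun h _ => ?_
  refine Eq.trans ?_ (smul_zero (∏ j : Fin n, α j (h j)))
  rw [← hcomb h, Finset.smul_sum]
  refine Finset.sum_congr rfl fun σ _ => ?_
  simp only [smul_smul]
  congr 1
  ring

end Superalgebra

/-! ### Counting equations against coefficients. -/

theorem exists_two_pow_mul_pow_mul_pow_lt_factorial (k : ℕ) :
    ∃ n : ℕ, 2 ^ (n + 2) * (k ^ n * k ^ n) < n.factorial := by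
  -- The left-hand side equals 4 (2k²)^n, and a factorial outgrows any such exponential.
  obtain ⟨n, hn⟩ := (Nat.eventually_mul_pow_lt_factorial_sub 4 (2 * (k * k)) 0).exists
  refine ⟨n, ?_⟩
  rw [Nat.sub_zero, mul_pow, mul_pow] at hn
  rw [pow_add]
  linarith

/-- There are more coefficients than linear equations on them. -/
theorem exists_ne_zero_forall_sum_koszulSign_eq_zero (F : Type*) [Field F] (K : Type*) [Fintype K]
    [DecidableEq K] : ∃ (n : ℕ) (c : Equiv.Perm (Fin n) → F), c ≠ 0 ∧
    ∀ (p : Fin (n + 2) → ZMod 2) (g h : Fin n → K),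
      ∑ σ : Equiv.Perm (Fin n), (if h ∘ σ = g then
        (koszulSign (fun i => if hi : i < n + 2 then p ⟨i, hi⟩ else 0)
          (rightNormedWord n σ).letters : F) else 0) * c σ = 0 := by
  obtain ⟨n, hn⟩ := exists_two_pow_mul_pow_mul_pow_lt_factorial (Fintype.card K)
  let M : Matrix ((Fin (n + 2) → ZMod 2) × (Fin n → K) × (Fin n → K)) (Equiv.Perm (Fin n)) F :=
    fun t σ => if t.2.2 ∘ σ = t.2.1 then
      (koszulSign (fun i => if hi : i < n + 2 then t.1 ⟨i, hi⟩ else 0)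
        (rightNormedWord n σ).letters : F) else 0
  have hker : LinearMap.ker M.mulVecLin ≠ ⊥ := by
    apply LinearMap.ker_ne_bot_of_finrank_lt
    rw [Module.finrank_fintype_fun_eq_card, Module.finrank_fintype_fun_eq_card, Fintype.card_perm]
    simpa using hn
  obtain ⟨c, hc, hc0⟩ := Submodule.exists_mem_ne_zero_of_ne_bot hker
  exact ⟨n, c, hc0, fun p g h => congrFun (LinearMap.mem_ker.1 hc) (p, g, h)⟩

end

noncomputable section

/-! ### A metabelian algebra with independent right-normed products -/

/-- The metabelian algebra on `T × T`, `T` an associative algebra, with product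
`(a, w) (b, w') = (0, a (b + w'))`. -/
def MetabelianDouble (T : Type*) : Type _ := T × T

namespace MetabelianDouble

variable {F : Type*} [Field F] {T : Type*} [Ring T] [Algebra F T]

/-- The element `(a, w)`. -/
def mk (a w : T) : MetabelianDouble T := (a, w)

instance : AddCommGroup (MetabelianDouble T) := inferInstanceAs (AddCommGroup (T × T))

instance : Module F (MetabelianDouble T) := inferInstanceAs (Module F (T × T))

/-- Products have first component zero, so they annihilate from the left, which gives the metabelian
law. As right factors they still count through their second component, so words can grow on the
left. -/
instance : Mul (MetabelianDouble T) := ⟨fun x y => mk 0 (x.1 * (y.1 + y.2))⟩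

instance : NonUnitalNonAssocRing (MetabelianDouble T) :=
  { (inferInstance : AddCommGroup (MetabelianDouble T)),
    (inferInstance : Mul (MetabelianDouble T)) with
    left_distrib := fun x y z => Prod.ext (add_zero (0 : T)).symm
      (show x.1 * (y.1 + z.1 + (y.2 + z.2)) = x.1 * (y.1 + y.2) + x.1 * (z.1 + z.2) by
        rw [← mul_add]; congr 1; abel)
    right_distrib := fun x y z => Prod.ext (add_zero (0 : T)).symm
      (show (x.1 + y.1) * (z.1 + z.2) = x.1 * (z.1 + z.2) + y.1 * (z.1 + z.2) from add_mul _ _ _)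
    zero_mul := fun x => Prod.ext rfl (show (0 : T) * (x.1 + x.2) = 0 from zero_mul _)
    mul_zero := fun x => Prod.ext rfl (show x.1 * ((0 : T) + 0) = 0 by simp) }

instance : IsScalarTower F (MetabelianDouble T) (MetabelianDouble T) where
  smul_assoc r x y := Prod.ext (smul_zero r).symm
    (show r • x.1 * (y.1 + y.2) = r • (x.1 * (y.1 + y.2)) from smul_mul_assoc _ _ _)

instance : SMulCommClass F (MetabelianDouble T) (MetabelianDouble T) where
  smul_comm r x y := Prod.ext (smul_zero r)
    (show r • (x.1 * (y.1 + y.2)) = x.1 * (r • y.1 + r • y.2) by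
      rw [← smul_add, mul_smul_comm])

theorem mul_mul_mul (a b c d : MetabelianDouble T) : a * b * (c * d) = 0 :=
  Prod.ext rfl (show (0 : T) * _ = 0 from zero_mul _)

theorem mk_mul_mk (a w b w' : T) : mk a w * mk b w' = mk 0 (a * (b + w')) := rfl

/-- A right-normed product of elements `(t i, 0)` records its letters, in order, in the second
component. -/
theorem lift_foldr (t : ℕ → T) (i j : ℕ) (l : List ℕ) :
    FreeMagma.lift (fun i => mk (t i) 0)
      (l.foldr (fun i m => FreeMagma.of i * m) (FreeMagma.of i * FreeMagma.of j)) =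
      mk 0 ((l ++ [i, j]).map t).prod := by
  induction l with
  | nil =>
    rw [List.foldr_nil, map_mul, FreeMagma.lift_of, FreeMagma.lift_of, mk_mul_mk]
    simp
  | cons k l ih =>
    rw [List.foldr_cons, map_mul, ih, FreeMagma.lift_of, mk_mul_mk]
    simp

end MetabelianDouble

/-! ### The separating superalgebra. -/

namespace Superalgebra

variable (F : Type u) [Field F]

/-- The metabelian double of the free associative algebra, as a superalgebra without odd part. -/
def metabelianWords : Superalgebra F where
  carrier := MetabelianDouble (MonoidAlgebra F (FreeMonoid ℕ))
  part i := if i = 0 then ⊤ else ⊥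
  isCompl := isCompl_top_bot
  mul_mem := by
    intro i j a b ha hb
    rcases (by decide : ∀ i j : ZMod 2, i + j = 0 ∨ i = 1 ∨ j = 1) i j with h | h | h
    · rw [if_pos h]; trivial
    · subst h
      rw [(Submodule.mem_bot F).1 ha, zero_mul]
      exact Submodule.zero_mem _
    · subst h
      rw [(Submodule.mem_bot F).1 hb, mul_zero]
      exact Submodule.zero_mem _

theorem metabelianWords_mem : metabelianWords F ∈ ofVariety (metabelianIdentities F) :=
  (mem_ofVariety_metabelianIdentities _).2
    (MetabelianDouble.mul_mul_mul (T := MonoidAlgebra F (FreeMonoid ℕ)))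

/-- Substituting free generators turns the permutations into distinct words of the free monoid,
which are linearly independent in its monoid algebra. -/
theorem eq_zero_of_metabelianWords_satisfiesSuper {n : ℕ} (c : Equiv.Perm (Fin n) → F)
    (h : (metabelianWords F).SatisfiesSuper (rightNormedPoly c)) : c = 0 := by
  let t : ℕ → MonoidAlgebra F (FreeMonoid ℕ) := fun i => MonoidAlgebra.single (FreeMonoid.of i) 1
  -- All variables are taken even, so every Koszul sign is 1.
  have h1 := (superEval_rightNormedPoly (metabelianWords F) 0 (fun i => MetabelianDouble.mk (t i) 0)
    c).symm.trans (h 0 _ fun i => trivial)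
  have ht : ∀ l : List ℕ, (l.map t).prod = MonoidAlgebra.single (FreeMonoid.ofList l) 1 := by
    intro l
    induction l with
    | nil => rfl
    | cons i l ih =>
      rw [List.map_cons, List.prod_cons, ih]
      exact (MonoidAlgebra.single_mul_single ..).trans (by rw [mul_one]; rfl)
  have h2 : ∑ σ, c σ • (MonoidAlgebra.single (FreeMonoid.ofList (rightNormedWord n σ).letters) 1 :
      MonoidAlgebra F (FreeMonoid ℕ)) = 0 := by
    let snd : MetabelianDouble (MonoidAlgebra F (FreeMonoid ℕ)) →ₗ[F]
      MonoidAlgebra F (FreeMonoid ℕ) := LinearMap.snd F _ _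
    refine Eq.trans ?_ (congrArg snd h1)
    refine Eq.trans ?_ (map_sum snd _ _).symm
    refine Finset.sum_congr rfl fun σ _ => ?_
    rw [koszulSign_zero, one_smul]
    refine Eq.trans ?_ (map_smul snd _ _).symm
    rw [letters_rightNormedWord, ← ht]
    exact congrArg (c σ • ·)
      (congrArg snd (MetabelianDouble.lift_foldr t n (n + 1) (List.ofFn fun i => (σ i : ℕ)))).symm
  have hinj : Function.Injective fun σ : Equiv.Perm (Fin n) =>
      FreeMonoid.ofList (rightNormedWord n σ).letters := by
    intro σ τ e
    have e1 : (rightNormedWord n σ).letters = (rightNormedWord n τ).letters := e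
    rw [letters_rightNormedWord, letters_rightNormedWord, List.append_cancel_right_eq,
      List.ofFn_inj] at e1
    exact Equiv.ext fun i => Fin.ext (congrFun e1 i)
  funext τ
  have h3 := congrArg
    (fun y => y.coeff (FreeMonoid.ofList (rightNormedWord n τ).letters)) h2
  simp only [MonoidAlgebra.coeff_sum, MonoidAlgebra.coeff_smul, MonoidAlgebra.coeff_single,
    Finsupp.finsetSum_apply, Finsupp.smul_apply, MonoidAlgebra.coeff_zero] at h3
  rw [Finset.sum_eq_single τ] at h3
  · simpa using h3
  · intro σ _ hne
    rw [Finsupp.single_eq_of_ne (fun e => hne (hinj e.symm)), smul_zero]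
  · simp

end Superalgebra

end

theorem mainTheorem11 (F : Type u) [Field F] [CharZero F] :
    HasInfiniteBasicSuperrank (metabelianIdentities F) := by
  intro r s heq
  obtain ⟨n, c, hc0, hc⟩ := exists_ne_zero_forall_sum_koszulSign_eq_zero F (Fin r ⊕ Fin s)
  have hB : Superalgebra.metabelianWords F ∈
      Superalgebra.superVar (metabelianIdentities F) r s := by
    rw [heq]
    exact Superalgebra.metabelianWords_mem F
  -- The graded ideal left implicit is the intersection that defines the free metabelian
  -- superalgebra.
  obtain ⟨x, hx⟩ := Superalgebra.exists_span_generators_sup_span_mul (F := F) r s _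
  exact hc0 (Superalgebra.eq_zero_of_metabelianWords_satisfiesSuper F c
    (hB _ (Superalgebra.isMultilinear_rightNormedPoly c)
      (Superalgebra.satisfiesSuper_rightNormedPoly _
        (Superalgebra.free_metabelianIdentities_mul_mul_mul r s) x hx c hc)))
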